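/- Let $\mathcal L$ be a relational language. A Fraïssé class here is a non-empty class of finite $\mathcal L$-structures, with countably many isomorphism types, that has the hereditary, joint embedding and amalgamation properties. A free amalgam of embeddings $f_0\colon A\to B_0$, $f_1\colon A\to B_1$ is a structure $C$ with embeddings $g_0\colon B_0\to C$, $g_1\colon B_1\to C$ such that $g_0f_0=g_1f_1$, $C=g_0(B_0)\cup g_1(B_1)$, $g_0(B_0)\cap g_1(B_1)=g_0f_0(A)$, and $R^C=g_0(R^{B_0})\cup g_1(R^{B_1})$ for every $R\in\mathcal L$. A free amalgamation class is a Fraïssé class closed under free amalgams. It is transitive if all vertices of all its members have the same quantifier-free type. Theorem. Let $\mathcal K$ be a transitive free amalgamation class of $\mathcal L$-structures. (1) $\mathcal K$ has the very canonical vertex-Ramsey property: for all $s\ge 1$ and all $B\in\mathcal K$ there are $C\in\mathcal K$ and a partition $V_0\sqcup\dots\sqcup V_{|B|-1}$ of the domain of $C$ such that, for any $s$ colourings $\chi_r\colon C\to\mathbb N$ ($r<s$), either there are $r<s$, $i<|B|$ and a substructure $B'\cong B$ of $C$ with domain contained in $V_i$ on which $\chi_r$ is constant, or there is a substructure $B'\cong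 B$ of $C$ with exactly one vertex in each $V_i$ such that every $\chi_r$, $r<s$, is injective on $B'$. (2) Hence $\mathcal K$ has the finite sunflower property: for all $k\ge 1$ and all $B\in\mathcal K$ there is $C\in\mathcal K$ such that every structure $C'\cong C$ whose elements are sets of size $k$ has a substructure $B'\cong B$ that is a sunflower, i.e. for which there is a set $c$ with $a\cap b=c$ for all distinct $a,b\in B'$. For example, for every $n$ the class of finite $K_n$-free graphs has the finite sunflower property. -/

import Mathlib

open FirstOrder.Language FirstOrder.Language.Structure CategoryTheory
open scoped FirstOrder

universe u v w z

namespace VertexRamsey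

section Amalgam

variable {L : FirstOrder.Language.{u, v}} {A B₀ B₁ C : Type w}
  [L.Structure A] [L.Structure B₀] [L.Structure B₁] [L.Structure C]

/-- `B₀ → C ← B₁` is a free amalgam of the pair of embeddings `B₀ ← A → B₁` of relational
structures: the square commutes, `C` is the union of the images of `B₀` and `B₁`, these images
meet exactly in the image of `A`, and the tuples of each relation of `C` are exactly the images
of the tuples of the relation in `B₀` and in `B₁`. -/
structure IsFreeAmalgam (f₀ : A ↪[L] B₀) (f₁ : A ↪[L] B₁) (g₀ : B₀ ↪[L] C) (g₁ : B₁ ↪[L] C) :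
    Prop where
  comm : g₀.comp f₀ = g₁.comp f₁
  union_eq : Set.range g₀ ∪ Set.range g₁ = Set.univ
  inter_eq : Set.range g₀ ∩ Set.range g₁ = Set.range (g₀.comp f₀)
  relMap_iff : ∀ (n : ℕ) (R : L.Relations n) (x : Fin n → C),
    RelMap R x ↔ (∃ y : Fin n → B₀, RelMap R y ∧ g₀ ∘ y = x) ∨
      (∃ y : Fin n → B₁, RelMap R y ∧ g₁ ∘ y = x)

end Amalgam

variable {L : FirstOrder.Language.{u, v}}

/-- A free amalgamation class is a Fraïssé class closed under free amalgams. -/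
structure IsFreeAmalgamationClass (K : Set (Bundled.{w} L.Structure)) : Prop where
  isFraisse : IsFraisse K
  free_mem : ∀ (A B₀ B₁ C : Bundled.{w} L.Structure)
    (f₀ : A ↪[L] B₀) (f₁ : A ↪[L] B₁) (g₀ : B₀ ↪[L] C) (g₁ : B₁ ↪[L] C),
    A ∈ K → B₀ ∈ K → B₁ ∈ K → IsFreeAmalgam f₀ f₁ g₀ g₁ → C ∈ K

variable (L) in
/-- The quantifier-free type (over the empty set) of an element of a structure. -/
def qfType {M : Type w} [L.Structure M] (x : M) : Set (L.Formula (Fin 1)) :=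
  {φ | φ.IsQF ∧ φ.Realize (fun _ => x)}

/-- A class of structures is transitive if all the vertices of all its members have the same
quantifier-free type. -/
def IsTransitiveClass (K : Set (Bundled.{w} L.Structure)) : Prop :=
  ∀ M ∈ K, ∀ N ∈ K, ∀ (x : M) (y : N), qfType L x = qfType L y

/-- `V 0, …, V (n - 1)` are pairwise disjoint with union `X`. -/
def IsPartition {X : Type w} {n : ℕ} (V : Fin n → Set X) : Prop :=
  (∀ i j, i ≠ j → Disjoint (V i) (V j)) ∧ ⋃ i, V i = Set.univ

/-- An `n`-set is a transversal of `V 0, …, V (n - 1)` if it meets each part in one point. -/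
def IsTransversal {X : Type w} {n : ℕ} (V : Fin n → Set X) (U : Set X) : Prop :=
  U.encard = n ∧ ∀ i, (U ∩ V i).encard = 1

/-- All points of `U` have the same colour. -/
def Monochromatic {X : Type w} (χ : X → ℕ) (U : Set X) : Prop :=
  ∃ q, ∀ x ∈ U, χ x = q

/-- Distinct points of `U` have distinct colours. -/
def Heterochromatic {X : Type w} (χ : X → ℕ) (U : Set X) : Prop :=
  Set.InjOn χ U

/-- The very canonical vertex-Ramsey property of a class of finite structures. -/
def VeryCanonicalVertexRamsey (K : Set (Bundled.{w} L.Structure)) : Prop :=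
  ∀ s : ℕ, 1 ≤ s → ∀ B ∈ K, ∃ C ∈ K, ∃ V : Fin (Nat.card B) → Set C, IsPartition V ∧
    ∀ χ : Fin s → C → ℕ,
      (∃ (r : Fin s) (i : Fin (Nat.card B)) (B' : L.Substructure C),
        (B' : Set C) ⊆ V i ∧ Nonempty (B' ≃[L] B) ∧ Monochromatic (χ r) B') ∨
      (∃ B' : L.Substructure C,
        IsTransversal V (B' : Set C) ∧ Nonempty (B' ≃[L] B) ∧ ∀ r, Heterochromatic (χ r) B')

/-- A family of sets is a sunflower if any two distinct members have the same intersection. -/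
def IsSunflower {α : Type z} (S : Set (Set α)) : Prop :=
  ∃ c : Set α, ∀ a ∈ S, ∀ b ∈ S, a ≠ b → a ∩ b = c

/-- The finite `k`-sunflower property: for each `B` in the class there is `C` in the class such
that each structure isomorphic to `C` whose domain `D` is a collection of `k`-element sets has a
substructure which is isomorphic to `B` and whose domain is a sunflower. -/
def FiniteKSunflowerProperty (K : Set (Bundled.{w} L.Structure)) (k : ℕ) : Prop :=
  ∀ B ∈ K, ∃ C ∈ K, ∀ (α : Type z) (D : Set (Set α)) [L.Structure D],
    (∀ a ∈ D, a.encard = k) → Nonempty (D ≃[L] C) →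
      ∃ S : L.Substructure D, Nonempty (S ≃[L] B) ∧ IsSunflower (Subtype.val '' (S : Set D))

/-- The finite sunflower property. -/
def FiniteSunflowerProperty (K : Set (Bundled.{w} L.Structure)) : Prop :=
  ∀ k : ℕ, 1 ≤ k → FiniteKSunflowerProperty.{u, v, w, z} K k

/-- The class of finite `K_n`-free simple graphs, as structures in the language of graphs. -/
def cliqueFreeGraphs (n : ℕ) : Set (Bundled.{w} FirstOrder.Language.graph.Structure) :=
  {M | Finite M ∧ ∃ G : SimpleGraph M, M.str = G.structure ∧ G.CliqueFree n}

end VertexRamsey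

/-! The plan is to glue copies of `B` along the edges of a sparse hypergraph on `n = |B|` parts of
size `N`. Its edges are either transversals of the parts or tuples inside one part. For any `s`
colourings there is a dichotomy. If some colour class is dense in some part, then many edges inside
that part are monochromatic. Otherwise colour coincidences are rare, and most transversal edges are
heterochromatic. So the good edges form a fixed positive proportion of all edges
(`le_card_mono_or_hetero`).

Not all edges can be kept: to control the glued structure, the hypergraph must be linear and
triangle-free. `exists_greedy_transversal` selects edges one at a time. Each chosen edge serves a
fixed proportion of the colourings not yet served. Only equality of colours matters, so there are
finitely many colourings and a number of edges of order `N log N` suffices. With degrees capped, so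
few edges violate sparseness that almost all stay available throughout
(`exists_sparse_partite_hypergraph`).

In the glued structure, the vertices of an irreducible substructure are pairwise collinear, hence
lie in one edge, so the substructure embeds in `B`. A class closed under free amalgams contains
every finite structure whose irreducible substructures it contains
(`IsTransitiveFreeClass.substructure_mem_of_irreducible`), so the glued structure belongs to `K`.
Transitivity makes copies of `B` agree at a shared vertex.

The sunflower property follows by induction on `k`, colouring each set by its enumerated elements. A
monochromatic copy has a common element, which is removed. A heterochromatic copy consists of
pairwise disjoint sets, because the Ramsey statement is proved in a form that also excludes
coincidences between different colourings (`IsTransitiveFreeClass.exists_partition`). -/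

namespace VertexRamsey

/-! ### Sparse hypergraphs and greedy selection of edges -/

section Hypergraph

open Finset

variable {ι V E : Type*}

/-- Two vertices are collinear if some edge of `F` contains both of them. -/
def Collinear (pt : E → ι → V) (F : Set E) (a b : V) : Prop :=
  ∃ e ∈ F, a ∈ Set.range (pt e) ∧ b ∈ Set.range (pt e)

/-- Two vertices are near if they are joined by a path of at most two edges. -/
def Near (pt : E → ι → V) (F : Set E) (a b : V) : Prop :=
  a = b ∨ Collinear pt F a b ∨ ∃ c, Collinear pt F a c ∧ Collinear pt F c b

/-- The edges in `F`, listed by `pt`, form a linear hypergraph without triangles. -/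
structure IsSparse (pt : E → ι → V) (F : Set E) : Prop where
  inj : ∀ e ∈ F, Function.Injective (pt e)
  linear : ∀ e ∈ F, ∀ e' ∈ F, ∀ a b, a ≠ b → a ∈ Set.range (pt e) → b ∈ Set.range (pt e) →
    a ∈ Set.range (pt e') → b ∈ Set.range (pt e') → e = e'
  triangle : ∀ a b c, a ≠ b → b ≠ c → a ≠ c → Collinear pt F a b → Collinear pt F b c →
    Collinear pt F a c →
      ∃ e ∈ F, a ∈ Set.range (pt e) ∧ b ∈ Set.range (pt e) ∧ c ∈ Set.range (pt e)

theorem Collinear.symm {pt : E → ι → V} {F : Set E} {a b : V} (h : Collinear pt F a b) :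
    Collinear pt F b a :=
  let ⟨e, he, ha, hb⟩ := h
  ⟨e, he, hb, ha⟩

theorem collinear_insert_iff {pt : E → ι → V} {F : Set E} {e : E} {a b : V} :
    Collinear pt (insert e F) a b ↔
      (a ∈ Set.range (pt e) ∧ b ∈ Set.range (pt e)) ∨ Collinear pt F a b := by
  simp [Collinear]

theorem isSparse_empty (pt : E → ι → V) : IsSparse pt ∅ where
  inj := by simp
  linear := by simp
  triangle := by simp [Collinear]

/-- A second edge through two points of `e`, or a triangle with exactly one side on `e`, would give
a path of at most two old edges between two points of `e`. If two sides lie on `e`, the three points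
all do. -/
theorem IsSparse.insert {pt : E → ι → V} {F : Set E} (hF : IsSparse pt F) {e : E}
    (he : ∀ j k, j ≠ k → ¬ Near pt F (pt e j) (pt e k)) : IsSparse pt (insert e F) := by
  have hne : ∀ a b, a ≠ b → a ∈ Set.range (pt e) → b ∈ Set.range (pt e) → ¬ Near pt F a b := by
    rintro _ _ hab ⟨j, rfl⟩ ⟨k, rfl⟩
    exact he j k fun h => hab (h ▸ rfl)
  refine ⟨?_, ?_, ?_⟩
  · rintro e' (rfl | h)
    · intro j k hjk
      by_contra hne
      exact he j k hne (Or.inl hjk)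
    · exact hF.inj e' h
  · rintro e₁ (rfl | h₁) e₂ (rfl | h₂) a b hab ha hb ha' hb'
    · rfl
    · exact absurd (Or.inr (Or.inl ⟨e₂, h₂, ha', hb'⟩)) (hne a b hab ha hb)
    · exact absurd (Or.inr (Or.inl ⟨e₁, h₁, ha, hb⟩)) (hne a b hab ha' hb')
    · exact hF.linear e₁ h₁ e₂ h₂ a b hab ha hb ha' hb'
  · intro a b c hab hbc hac h₁ h₂ h₃
    rw [collinear_insert_iff] at h₁ h₂ h₃
    rcases h₁ with ⟨ha, hb⟩ | h₁
    · rcases h₂ with ⟨-, hc⟩ | h₂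
      · exact ⟨e, Set.mem_insert _ _, ha, hb, hc⟩
      rcases h₃ with ⟨-, hc⟩ | h₃
      · exact ⟨e, Set.mem_insert _ _, ha, hb, hc⟩
      exact absurd (Or.inr (Or.inr ⟨c, h₃, h₂.symm⟩)) (hne a b hab ha hb)
    · rcases h₂ with ⟨hb, hc⟩ | h₂
      · rcases h₃ with ⟨ha, -⟩ | h₃
        · exact ⟨e, Set.mem_insert _ _, ha, hb, hc⟩
        exact absurd (Or.inr (Or.inr ⟨a, h₁.symm, h₃⟩)) (hne b c hbc hb hc)
      rcases h₃ with ⟨ha, hc⟩ | h₃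
      · exact absurd (Or.inr (Or.inr ⟨b, h₁, h₂⟩)) (hne a c hac ha hc)
      · obtain ⟨e', he', h⟩ := hF.triangle a b c hab hbc hac h₁ h₂ h₃
        exact ⟨e', Set.mem_insert_of_mem _ he', h⟩

/-- A set of pairwise collinear points, at least two in number, lies in an edge. -/
theorem IsSparse.subset_edge {pt : E → ι → V} {F : Set E} (hF : IsSparse pt F) {S : Set V}
    (hS : ∀ a ∈ S, ∀ b ∈ S, a ≠ b → Collinear pt F a b) (hnt : S.Nontrivial) :
    ∃ e ∈ F, S ⊆ Set.range (pt e) := by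
  obtain ⟨a, ha, b, hb, hab⟩ := hnt
  obtain ⟨e, he, hae, hbe⟩ := hS a ha b hb hab
  refine ⟨e, he, fun c hc => ?_⟩
  by_cases hca : a = c
  · exact hca ▸ hae
  by_cases hcb : b = c
  · exact hcb ▸ hbe
  obtain ⟨e', he', ha', hb', hc'⟩ := hF.triangle a b c hab hcb hca (hS a ha b hb hab)
    (hS b hb c hc hcb) (hS a ha c hc hca)
  rwa [hF.linear e he e' he' a b hab hae hbe ha' hb']

open Classical in
/-- The number of edges of `F` through a vertex. -/
noncomputable def edgeDegree (pt : E → ι → V) (F : Finset E) (a : V) : ℕ :=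
  #{e ∈ F | a ∈ Set.range (pt e)}

open Classical in
theorem edgeDegree_insert_le [DecidableEq E] (pt : E → ι → V) (F : Finset E) (e : E) (a : V) :
    edgeDegree pt (insert e F) a ≤
      edgeDegree pt F a + if a ∈ Set.range (pt e) then 1 else 0 := by
  unfold edgeDegree
  rw [filter_insert]
  split_ifs
  · exact card_insert_le _ _
  · simp

theorem sum_edgeDegree_le [Fintype ι] [Fintype V] (pt : E → ι → V) (F : Finset E) :
    ∑ a, edgeDegree pt F a ≤ #F * Fintype.card ι := by
  classical
  unfold edgeDegree
  simp_rw [card_filter]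
  rw [sum_comm]
  refine (sum_le_card_nsmul _ _ (Fintype.card ι) fun e _ => ?_).trans (by simp)
  calc _ = #{a | a ∈ Set.range (pt e)} := by rw [card_filter]; congr!
    _ ≤ #(univ.image (pt e)) := card_le_card fun a => by simp
    _ ≤ _ := card_image_le

theorem card_high_degree_mul_le [Fintype ι] [Fintype V] (pt : E → ι → V) (F : Finset E) (d : ℕ) :
    #{a | d ≤ edgeDegree pt F a} * d ≤ #F * Fintype.card ι := by
  refine le_trans ?_ (sum_edgeDegree_le pt F)
  rw [← smul_eq_mul]
  exact (card_nsmul_le_sum _ _ d (by simp)).trans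
    (sum_le_sum_of_subset (filter_subset _ _))

-- With degrees at most `d`, a point has at most `1 + d * |ι|` points within one edge, itself
-- included; two such steps give the square. This bounds the pairs that a new edge must avoid.
open Classical in
theorem card_near_le [Fintype ι] [Fintype V] (pt : E → ι → V) (F : Finset E) (d : ℕ)
    (hd : ∀ a, edgeDegree pt F a ≤ d) :
    #{p : V × V | Near pt F p.1 p.2} ≤ Fintype.card V * (1 + d * Fintype.card ι) ^ 2 := by
  set nb : V → Finset V := fun a =>
    insert a ({e ∈ F | a ∈ Set.range (pt e)}.biUnion fun e => univ.image (pt e)) with hnb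
  have hcard : ∀ a, #(nb a) ≤ 1 + d * Fintype.card ι := fun a => by
    refine (card_insert_le _ _).trans ?_
    rw [add_comm]
    refine Nat.add_le_add_left ?_ 1
    refine (card_biUnion_le_card_mul _ _ (Fintype.card ι) fun e _ => card_image_le).trans ?_
    exact Nat.mul_le_mul_right _ (by unfold edgeDegree at hd; convert hd a)
  have hself : ∀ a, a ∈ nb a := fun a => mem_insert_self _ _
  have hcol : ∀ a b, Collinear pt F a b → b ∈ nb a := by
    rintro a b ⟨e, he, ha, hb⟩
    refine mem_insert_of_mem (mem_biUnion.2 ⟨e, mem_filter.2 ⟨he, ha⟩, ?_⟩)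
    simpa using hb
  have hsub : ({p : V × V | Near pt F p.1 p.2} : Finset (V × V)) ⊆
      (univ : Finset V).biUnion fun a => ((nb a).biUnion nb).image fun b => (a, b) := by
    rintro ⟨a, b⟩ h
    simp only [mem_filter, mem_univ, true_and] at h
    simp only [mem_biUnion, mem_univ, true_and, mem_image, Prod.mk.injEq]
    refine ⟨a, b, ?_, rfl, rfl⟩
    rcases h with rfl | h | ⟨c, h, h'⟩
    · exact ⟨a, hself a, hself a⟩
    · exact ⟨a, hself a, hcol a b h⟩
    · exact ⟨c, hcol a c h, hcol c b h'⟩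
  refine (card_le_card hsub).trans (card_biUnion_le_card_mul _ _ _ fun a _ => ?_)
  refine card_image_le.trans ?_
  rw [sq]
  exact (card_biUnion_le_card_mul _ _ _ fun b _ => hcard b).trans (Nat.mul_le_mul_right _ (hcard a))

/-- Greedy choice of a transversal: targets which contain a proportion `2 * c` of all edges are
met by a set of edges built one by one, as long as at each stage all but a proportion `c` of the
edges may be added. -/
theorem exists_greedy_transversal {T : Type*} [Fintype E] [Fintype T] [DecidableEq E] [Nonempty E]
    (t : T → Finset E) (P : Finset E → Prop) (c : ℝ) (m : ℕ) (hP : P ∅) (hc : c ≤ 1)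
    (hstep : ∀ F, P F → #F < m → ∃ A : Finset E, (∀ e ∈ A, P (insert e F)) ∧
      (#Aᶜ : ℝ) ≤ c * Fintype.card E)
    (ht : ∀ i, 2 * c * Fintype.card E ≤ #(t i))
    (hm : (1 - c) ^ m * Fintype.card T < 1) : ∃ F, P F ∧ ∀ i, ∃ e ∈ F, e ∈ t i := by
  classical
  suffices h : ∀ k ≤ m, ∃ F, P F ∧ #F ≤ k ∧
      (#{i | ∀ e ∈ F, e ∉ t i} : ℝ) ≤ (1 - c) ^ k * Fintype.card T by
    obtain ⟨F, hF, -, h⟩ := h m le_rfl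
    refine ⟨F, hF, fun i => ?_⟩
    have h0 : #{i | ∀ e ∈ F, e ∉ t i} = 0 := by
      have := h.trans_lt hm
      have : #{i | ∀ e ∈ F, e ∉ t i} < 1 := by exact_mod_cast this
      omega
    by_contra! hcon
    rw [card_eq_zero] at h0
    exact notMem_empty i (h0 ▸ mem_filter.2 ⟨mem_univ _, hcon⟩)
  intro k
  induction k with
  | zero =>
    intro _
    exact ⟨∅, hP, by simp, by simp⟩
  | succ k ih =>
    intro hk
    obtain ⟨F, hF, hcard, hU⟩ := ih (by omega)
    obtain ⟨A, hA, hAc⟩ := hstep F hF (by omega)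
    set U : Finset T := {i | ∀ e ∈ F, e ∉ t i} with hUdef
    rcases U.eq_empty_or_nonempty with hUe | hUne
    · refine ⟨F, hF, by omega, ?_⟩
      rw [← hUdef, hUe, Finset.card_empty, Nat.cast_zero]
      have : 0 ≤ 1 - c := by linarith
      positivity
    have hEpos : (0 : ℝ) < Fintype.card E := by exact_mod_cast Fintype.card_pos
    -- Averaging: a target has proportion at least `2 * c` of all edges and loses at most `c`
    -- outside `A`. So some allowed edge meets a proportion `c` of the unmet targets `U`.
    have hex : ∃ e ∈ A, c * #U ≤ (#{i ∈ U | e ∈ t i} : ℝ) := by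
      by_contra! hcon
      have hsum : (∑ e ∈ A, (#{i ∈ U | e ∈ t i} : ℝ)) = ∑ i ∈ U, (#(t i ∩ A) : ℝ) := by
        have : ∑ e ∈ A, #{i ∈ U | e ∈ t i} = ∑ i ∈ U, #(t i ∩ A) := by
          simp_rw [card_filter]
          rw [sum_comm]
          refine sum_congr rfl fun i _ => ?_
          rw [← card_filter, inter_comm]
          exact congrArg Finset.card filter_mem_eq_inter
        exact_mod_cast this
      have hlow : ∀ i ∈ U, c * Fintype.card E ≤ (#(t i ∩ A) : ℝ) := fun i _ => by
        have h1 : #(t i) ≤ #(t i ∩ A) + #Aᶜ := by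
          rw [← card_inter_add_card_sdiff (t i) A]
          exact Nat.add_le_add_left (card_le_card fun e he => by simpa using fun h => (mem_sdiff.1 he).2 h) _
        have h1' : (#(t i) : ℝ) ≤ #(t i ∩ A) + #Aᶜ := by exact_mod_cast h1
        have := ht i
        linarith
      have h1 : (#U : ℝ) * (c * Fintype.card E) ≤ ∑ e ∈ A, (#{i ∈ U | e ∈ t i} : ℝ) := by
        rw [hsum]
        have := card_nsmul_le_sum U _ _ hlow
        simpa [nsmul_eq_mul] using this
      have hUpos : (0 : ℝ) < #U := by exact_mod_cast hUne.card_pos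
      have hcA : 0 < #A := by
        obtain ⟨i, hi⟩ := hUne
        by_contra h0
        have hA0 : A = ∅ := by rw [← card_eq_zero]; omega
        have hcE : (Fintype.card E : ℝ) ≤ c * Fintype.card E := by
          simpa [hA0] using hAc
        have h2 := hlow i hi
        rw [hA0] at h2
        simp only [inter_empty, Finset.card_empty, Nat.cast_zero] at h2
        linarith
      have h2 : ∑ e ∈ A, (#{i ∈ U | e ∈ t i} : ℝ) < ∑ _e ∈ A, c * (#U : ℝ) :=
        sum_lt_sum_of_nonempty (card_pos.1 hcA) hcon
      rw [sum_const, nsmul_eq_mul] at h2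
      have h3 : (#A : ℝ) ≤ Fintype.card E := by exact_mod_cast card_le_univ A
      have hc0 : 0 ≤ c := by
        by_contra! hneg
        have : c * Fintype.card E < 0 := mul_neg_of_neg_of_pos hneg hEpos
        have h4 : (0 : ℝ) ≤ #Aᶜ := by positivity
        linarith
      have h4 : (#A : ℝ) * (c * #U) ≤ Fintype.card E * (c * #U) := by gcongr
      nlinarith
    obtain ⟨e, heA, he⟩ := hex
    refine ⟨insert e F, hA e heA, (card_insert_le _ _).trans (by omega), ?_⟩
    have heq : #{i | ∀ e' ∈ insert e F, e' ∉ t i} + #{i ∈ U | e ∈ t i} = #U := by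
      rw [add_comm, ← card_filter_add_card_filter_not (s := U) (fun i => e ∈ t i)]
      congr 2
      ext i
      simp [hUdef, and_comm]
    have heq' : (#{i | ∀ e' ∈ insert e F, e' ∉ t i} : ℝ) + #{i ∈ U | e ∈ t i} = #U := by
      exact_mod_cast heq
    have h5 : (1 - c) * #U ≤ (1 - c) * ((1 - c) ^ k * Fintype.card T) :=
      mul_le_mul_of_nonneg_left hU (by linarith)
    rw [pow_succ]
    linarith

end Hypergraph

/-! ### Counting functions with one or two prescribed coordinates -/

section Counting

open Finset

variable {ι α : Type*} [Fintype ι] [DecidableEq ι] [Fintype α] [DecidableEq α]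

/-- Overwriting the `j`-th value of `f` by `a` and remembering `f j` loses no information about `(f,
a)`. The product form avoids division. -/
theorem card_filter_apply_mul_le (j : ι) (P : Finset α) :
    #{f : ι → α | f j ∈ P} * Fintype.card α ≤ #P * Fintype.card α ^ Fintype.card ι := by
  rw [← card_univ (α := α), ← card_product, card_univ, ← Fintype.card_fun, ← card_univ,
    ← card_product]
  refine card_le_card_of_injOn (fun x => (x.1 j, Function.update x.1 j x.2)) ?_ ?_
  · rintro ⟨f, a⟩ hx
    simpa using hx
  · rintro ⟨f, a⟩ - ⟨f', a'⟩ - h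
    simp only [Prod.mk.injEq] at h ⊢
    have h' := fun i => congrFun h.2 i
    constructor
    · funext i
      by_cases hi : i = j
      · exact hi ▸ h.1
      · simpa [hi] using h' i
    · simpa using h' j

theorem card_filter_apply_apply_mul_le {j k : ι} (hjk : j ≠ k) (P : Finset (α × α)) :
    #{f : ι → α | (f j, f k) ∈ P} * Fintype.card α ^ 2 ≤
      #P * Fintype.card α ^ Fintype.card ι := by
  rw [sq, ← Fintype.card_prod, ← card_univ (α := α × α), ← card_product, ← Fintype.card_fun,
    ← card_univ, ← card_product]
  refine card_le_card_of_injOn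
    (fun x => ((x.1 j, x.1 k), Function.update (Function.update x.1 j x.2.1) k x.2.2)) ?_ ?_
  · rintro ⟨f, a, b⟩ hx
    simpa using hx
  · rintro ⟨f, a, b⟩ - ⟨f', a', b'⟩ - h
    simp only [Prod.mk.injEq] at h ⊢
    have h' := fun i => congrFun h.2 i
    refine ⟨?_, ?_, ?_⟩
    · funext i
      by_cases hi : i = j
      · exact hi ▸ h.1.1
      by_cases hi' : i = k
      · exact hi' ▸ h.1.2
      · simpa [hi, hi'] using h' i
    · simpa [hjk] using h' j
    · simpa using h' k

end Counting

/-! ### The sparse partite hypergraph that serves all colourings -/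

section Partite

open Finset

/-- The vertices of the edge `e` on the vertex set `Fin n × Fin N`: if `e.1 = none` the edge is a
transversal of the `n` parts, and if `e.1 = some i` it lies in the `i`-th part. -/
def edgePoint (n N : ℕ) (e : Option (Fin n) × (Fin n → Fin N)) (j : Fin n) : Fin n × Fin N :=
  (e.1.getD j, e.2 j)

/-- The edge `e` lies in one of the parts, and one of the colourings is constant on it. -/
def MonoEdge {n N s : ℕ} {β : Type*} (χ : Fin s × (Fin n × Fin N) → β)
    (e : Option (Fin n) × (Fin n → Fin N)) : Prop :=
  ∃ i, e.1 = some i ∧ ∃ r q, ∀ j, χ (r, edgePoint n N e j) = q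

/-- The edge `e` is a transversal, and no two distinct vertices of it share a colour, not even in
different colourings. -/
def HeteroEdge {n N s : ℕ} {β : Type*} (χ : Fin s × (Fin n × Fin N) → β)
    (e : Option (Fin n) × (Fin n → Fin N)) : Prop :=
  e.1 = none ∧ ∀ r t j k, j ≠ k → χ (r, edgePoint n N e j) ≠ χ (t, edgePoint n N e k)

theorem card_filter_edgePoint_mul_le {n N : ℕ} (j : Fin n) (P : Finset (Fin n × Fin N)) :
    #{e | edgePoint n N e j ∈ P} * N ≤ (n + 1) * (#P * N ^ n) := by
  rw [card_filter, Fintype.sum_prod_type, sum_mul]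
  refine (sum_le_card_nsmul _ _ (#P * N ^ n) fun τ _ => ?_).trans (by simp)
  rw [← card_filter]
  have h := card_filter_apply_mul_le (α := Fin N) j {a | (τ.getD j, a) ∈ P}
  simp only [mem_filter, mem_univ, true_and, Fintype.card_fin] at h
  refine h.trans (Nat.mul_le_mul_right _ ?_)
  refine card_le_card_of_injOn (fun a => (τ.getD j, a)) (fun a ha => by simpa using ha) ?_
  intro a _ b _ hab
  exact (Prod.mk.inj hab).2

theorem card_filter_edgePoint_edgePoint_mul_le {n N : ℕ} {j k : Fin n} (hjk : j ≠ k)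
    (P : Finset ((Fin n × Fin N) × (Fin n × Fin N))) :
    #{e | (edgePoint n N e j, edgePoint n N e k) ∈ P} * N ^ 2 ≤ (n + 1) * (#P * N ^ n) := by
  rw [card_filter, Fintype.sum_prod_type, sum_mul]
  refine (sum_le_card_nsmul _ _ (#P * N ^ n) fun τ _ => ?_).trans (by simp)
  rw [← card_filter]
  have h := card_filter_apply_apply_mul_le (α := Fin N) hjk
    {x | ((τ.getD j, x.1), (τ.getD k, x.2)) ∈ P}
  simp only [mem_filter, mem_univ, true_and, Fintype.card_fin] at h
  refine h.trans (Nat.mul_le_mul_right _ ?_)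
  refine card_le_card_of_injOn (fun x => ((τ.getD j, x.1), (τ.getD k, x.2)))
    (fun x hx => by simpa using hx) ?_
  rintro ⟨a, b⟩ _ ⟨a', b'⟩ _ h
  simpa using h

-- If a colour class has at least `δ * N` points in one part, all `n`-tuples from it give
-- monochromatic edges. Otherwise each of the at most `s² n²` possible coincidences affects at most
-- `δ * N ^ n` transversals, so at least half of them are heterochromatic.
open Classical in
theorem le_card_mono_or_hetero {n N s : ℕ} {β : Type*} (χ : Fin s × (Fin n × Fin N) → β) {δ : ℝ}
    (hδ : 0 < δ) (hn : 0 < n) (hδ' : δ ≤ 1 / 2) (hδs : δ * (s ^ 2 * n ^ 2) ≤ 1 / 2) :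
    δ ^ n * N ^ n ≤ (#{e | MonoEdge χ e ∨ HeteroEdge χ e} : ℝ) := by
  by_cases h : ∃ r i q, δ * N ≤ (#{a | χ (r, (i, a)) = q} : ℝ)
  · obtain ⟨r, i, q, h⟩ := h
    have hcard : #{a | χ (r, (i, a)) = q} ^ n ≤ #{e | MonoEdge χ e ∨ HeteroEdge χ e} := by
      have := Fintype.card_piFinset_const {a | χ (r, (i, a)) = q} n
      rw [← this]
      refine card_le_card_of_injOn (fun f => (some i, f)) ?_ ?_
      · intro f hf
        refine mem_coe.2 (mem_filter.2 ⟨mem_univ _, Or.inl ⟨i, rfl, r, q, fun j => ?_⟩⟩)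
        exact (mem_filter.1 (Fintype.mem_piFinset.1 hf j)).2
      · intro f _ f' _ hff
        exact (Prod.mk.inj hff).2
    calc δ ^ n * N ^ n = (δ * N) ^ n := (mul_pow _ _ _).symm
      _ ≤ (#{a | χ (r, (i, a)) = q} : ℝ) ^ n := by gcongr
      _ ≤ _ := by exact_mod_cast hcard
  · push Not at h
    set bad : Finset (Fin n → Fin N) :=
      {f | ∃ r t j k, j ≠ k ∧ χ (r, (j, f j)) = χ (t, (k, f k))} with hbad
    have hone : ∀ r t j k, j ≠ k →
        (#{f : Fin n → Fin N | χ (r, (j, f j)) = χ (t, (k, f k))} : ℝ) ≤ δ * N ^ n := by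
      intro r t j k hjk
      have h1 := card_filter_apply_apply_mul_le (α := Fin N) hjk
        {x | χ (r, (j, x.1)) = χ (t, (k, x.2))}
      simp only [mem_filter, mem_univ, true_and, Fintype.card_fin] at h1
      have h2 : (#{x : Fin N × Fin N | χ (r, (j, x.1)) = χ (t, (k, x.2))} : ℝ) ≤
          N * (δ * N) := by
        rw [card_filter, Fintype.sum_prod_type]
        push_cast
        refine (sum_le_card_nsmul _ _ (δ * N) fun a _ => ?_).trans (by simp)
        have h3 := (h t k (χ (r, (j, a)))).le
        rw [card_filter] at h3
        push_cast at h3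
        simpa [eq_comm] using h3
      rcases Nat.eq_zero_or_pos N with rfl | hN
      · have : IsEmpty (Fin n → Fin 0) := ⟨fun f => (f ⟨0, hn⟩).elim0⟩
        rw [Finset.eq_empty_of_isEmpty (Finset.filter _ _)]
        simp only [Finset.card_empty, Nat.cast_zero]
        positivity
      · have hN' : (0 : ℝ) < N := by exact_mod_cast hN
        have h1' : (#{f : Fin n → Fin N | χ (r, (j, f j)) = χ (t, (k, f k))} : ℝ) * N ^ 2 ≤
            #{x : Fin N × Fin N | χ (r, (j, x.1)) = χ (t, (k, x.2))} * N ^ n := by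
          exact_mod_cast h1
        refine le_of_mul_le_mul_right ?_ (pow_pos hN' 2)
        calc _ ≤ _ := h1'
          _ ≤ N * (δ * N) * N ^ n := by gcongr
          _ = _ := by ring
    have hbadcard : (#bad : ℝ) ≤ N ^ n / 2 := by
      have hsub : bad ⊆ (univ : Finset ((Fin s × Fin s) × (Fin n × Fin n))).biUnion fun x =>
          if x.2.1 ≠ x.2.2 then
            ({f | χ (x.1.1, (x.2.1, f x.2.1)) = χ (x.1.2, (x.2.2, f x.2.2))} :
              Finset (Fin n → Fin N))
          else ∅ := by
        intro f hf
        obtain ⟨r, t, j, k, hjk, hf⟩ := (mem_filter.1 hf).2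
        refine mem_biUnion.2 ⟨((r, t), (j, k)), mem_univ _, ?_⟩
        rw [if_pos hjk]
        simpa using hf
      have h1 : (#bad : ℝ) ≤ ∑ x : (Fin s × Fin s) × (Fin n × Fin n), δ * (N : ℝ) ^ n := by
        have h2 := (card_le_card hsub).trans card_biUnion_le
        have h2' := (Nat.cast_le (α := ℝ)).2 h2
        push_cast at h2'
        refine h2'.trans (sum_le_sum fun x _ => ?_)
        split_ifs with hx
        · exact hone _ _ _ _ hx
        · simp only [Finset.card_empty, Nat.cast_zero]
          positivity
      rw [sum_const, nsmul_eq_mul] at h1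
      simp only [card_univ, Fintype.card_prod, Fintype.card_fin, Nat.cast_mul] at h1
      calc (#bad : ℝ) ≤ _ := h1
        _ = δ * (s ^ 2 * n ^ 2) * N ^ n := by ring
        _ ≤ 1 / 2 * N ^ n := by gcongr
        _ = _ := by ring
    have hcompl : #badᶜ ≤ #{e | MonoEdge χ e ∨ HeteroEdge χ e} := by
      refine card_le_card_of_injOn (fun f => (none, f)) ?_ ?_
      · intro f hf
        refine mem_coe.2 (mem_filter.2 ⟨mem_univ _, Or.inr ⟨rfl, fun r t j k hjk heq => ?_⟩⟩)
        have hf' : f ∉ bad := mem_compl.1 hf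
        exact hf' (mem_filter.2 ⟨mem_univ _, r, t, j, k, hjk, heq⟩)
      · intro f _ f' _ hff
        exact (Prod.mk.inj hff).2
    have htot : #bad + #badᶜ = N ^ n := by
      rw [card_add_card_compl]
      simp
    have htot' : (#bad : ℝ) + #badᶜ = N ^ n := by exact_mod_cast htot
    have hcompl' : (#badᶜ : ℝ) ≤ #{e | MonoEdge χ e ∨ HeteroEdge χ e} := by exact_mod_cast hcompl
    have hpow : δ ^ n ≤ 1 / 2 :=
      (pow_le_of_le_one hδ.le (by linarith) hn.ne').trans hδ'
    have : δ ^ n * (N : ℝ) ^ n ≤ 1 / 2 * N ^ n := by gcongr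
    linarith

/-- The first inequality makes `m` greedy steps exhaust all colourings. The second bounds the
proportion of edges lost to near pairs, of order `d ^ 2 / N`, and to saturated vertices, of order `m
/ (d * N)`. Since `m` is about `N log N`, any `d` well between `log N` and `√N` works. -/
theorem exists_parameters (n s : ℕ) {c : ℝ} (hc : 0 < c) (hc' : c ≤ 1) :
    ∃ N d m : ℕ, 0 < N ∧ 0 < d ∧
      (1 - c) ^ m * (((s * (n * N)) ^ (s * (n * N)) : ℕ) : ℝ) < 1 ∧
      (n : ℝ) ^ 2 * (n * N * (1 + d * n) ^ 2 / N ^ 2) + n * (m * n / d / N) ≤ c := by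
  obtain ⟨h, hh⟩ := exists_pow_lt_of_lt_one (show (0 : ℝ) < 1 / 2 by norm_num)
    (show 1 - c < 1 by linarith)
  have hlim : Filter.Tendsto
      (fun l : ℕ => ((n : ℝ) ^ 3 * (1 + n) ^ 2 + n ^ 2 * h * (s * n * (s * n) + 1)) * (1 / 2) ^ l +
        3 * (n ^ 2 * h * (s * n)) * ((l : ℝ) ^ 1 * (1 / 2) ^ l)) Filter.atTop
      (nhds (((n : ℝ) ^ 3 * (1 + n) ^ 2 + n ^ 2 * h * (s * n * (s * n) + 1)) * 0 +
        3 * (n ^ 2 * h * (s * n)) * 0)) := by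
    refine Filter.Tendsto.add (Filter.Tendsto.const_mul _ ?_) (Filter.Tendsto.const_mul _ ?_)
    · exact tendsto_pow_atTop_nhds_zero_of_lt_one (by norm_num) (by norm_num)
    · exact tendsto_pow_const_mul_const_pow_of_abs_lt_one 1 (by norm_num [abs_of_pos])
  simp only [mul_zero, add_zero] at hlim
  obtain ⟨l, hl⟩ := (hlim.eventually (gt_mem_nhds hc)).exists
  -- With `d = 2 ^ l` and `N = d ^ 3`, the losses are `O(1 / d)` and `O(l / d)`. The number of
  -- colourings is `K ^ K` with `K = s * n * N ≤ 2 ^ (s * n + 3 * l)`. Each block of `h` steps at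
  -- least halves the unserved ones, and the `+ 1` makes the final bound strict.
  refine ⟨(2 ^ l) ^ 3, 2 ^ l, h * ((s * n + 3 * l) * (s * n * (2 ^ l) ^ 3) + 1), by positivity,
    by positivity, ?_, ?_⟩
  · set K := s * n * (2 ^ l) ^ 3 with hK
    have hK' : s * (n * (2 ^ l) ^ 3) = K := by rw [hK]; ring
    rw [hK']
    have hKle : K ≤ 2 ^ (s * n + 3 * l) := by
      rw [hK, pow_add, mul_comm 3 l, pow_mul 2 l 3]
      exact Nat.mul_le_mul_right _ Nat.lt_two_pow_self.le
    have h1 : ((K ^ K : ℕ) : ℝ) ≤ 2 ^ ((s * n + 3 * l) * K) := by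
      have h2 := Nat.pow_le_pow_left hKle K
      rw [← pow_mul] at h2
      exact (Nat.cast_le.2 h2).trans_eq (by rw [Nat.cast_pow, Nat.cast_ofNat])
    have h0 : 0 ≤ 1 - c := by linarith
    calc (1 - c) ^ (h * ((s * n + 3 * l) * K + 1)) * ((K ^ K : ℕ) : ℝ)
        ≤ (1 / 2) ^ ((s * n + 3 * l) * K + 1) * 2 ^ ((s * n + 3 * l) * K) := by
          rw [pow_mul]
          gcongr
      _ = 1 / 2 * (1 / 2 * 2) ^ ((s * n + 3 * l) * K) := by rw [pow_succ, mul_pow]; ring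
      _ < 1 := by norm_num
  · refine le_trans ?_ hl.le
    push_cast
    have htpos : (0 : ℝ) < 2 ^ l := by positivity
    have ht1 : (1 : ℝ) ≤ 2 ^ l := one_le_pow₀ (by norm_num)
    have hinv : (1 / 2 : ℝ) ^ l = 1 / 2 ^ l := by rw [div_pow, one_pow]
    rw [hinv]
    set t : ℝ := 2 ^ l
    have e1 : (n : ℝ) ^ 2 * (n * t ^ 3 * (1 + t * n) ^ 2 / (t ^ 3) ^ 2) ≤
        (n : ℝ) ^ 3 * (1 + n) ^ 2 * (1 / t) := by
      have : (1 + t * n) ^ 2 ≤ (t * (1 + n)) ^ 2 := by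
        gcongr
        nlinarith
      calc (n : ℝ) ^ 2 * (n * t ^ 3 * (1 + t * n) ^ 2 / (t ^ 3) ^ 2)
          ≤ (n : ℝ) ^ 2 * (n * t ^ 3 * (t * (1 + n)) ^ 2 / (t ^ 3) ^ 2) := by gcongr
        _ = _ := by field_simp
    have e2 : (n : ℝ) * (h * ((s * n + 3 * l) * (s * n * t ^ 3) + 1) * n / t / t ^ 3) ≤
        n ^ 2 * h * (s * n * (s * n) + 1) * (1 / t) +
          3 * (n ^ 2 * h * (s * n)) * ((l : ℝ) ^ 1 * (1 / t)) := by
      have ht3 : (1 : ℝ) ≤ t ^ 3 := one_le_pow₀ ht1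
      calc (n : ℝ) * (h * ((s * n + 3 * l) * (s * n * t ^ 3) + 1) * n / t / t ^ 3)
          ≤ (n : ℝ) * (h * ((s * n + 3 * l) * (s * n * t ^ 3) + t ^ 3) * n / t / t ^ 3) := by
            gcongr
        _ = _ := by field_simp; ring
    linarith

theorem exists_sparse_partite_hypergraph {n : ℕ} (hn : 0 < n) (s : ℕ) :
    ∃ (N : ℕ) (F : Set (Option (Fin n) × (Fin n → Fin N))), IsSparse (edgePoint n N) F ∧
      ∀ χ : Fin s × (Fin n × Fin N) → Fin s × (Fin n × Fin N),
        ∃ e ∈ F, MonoEdge χ e ∨ HeteroEdge χ e := by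
  classical
  -- Chosen so that coincidences spoil at most half of the transversals; the `+ 1` covers `s = 0`.
  set δ : ℝ := 1 / (2 * (s ^ 2 * n ^ 2 + 1)) with hδdef
  have hδ : 0 < δ := by positivity
  have hδ2 : δ ≤ 1 / 2 := by
    rw [hδdef]
    gcongr
    have : (0 : ℝ) ≤ s ^ 2 * n ^ 2 := by positivity
    linarith
  have hδs : δ * (s ^ 2 * n ^ 2) ≤ 1 / 2 := by
    rw [hδdef, div_mul_eq_mul_div, div_le_div_iff₀ (by positivity) (by positivity)]
    linarith
  -- There are `(n + 1) * N ^ n` edges in all, so `2 * c` is exactly the guaranteed proportion of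
  -- good ones.
  set c : ℝ := δ ^ n / (2 * (n + 1)) with hcdef
  have hc : 0 < c := by positivity
  have hc1 : c ≤ 1 := by
    rw [hcdef, div_le_one (by positivity)]
    have : δ ^ n ≤ 1 := pow_le_one₀ hδ.le (by linarith)
    have : (0 : ℝ) ≤ n := by positivity
    linarith
  obtain ⟨N, d, m, hN, hd, hm, hpar⟩ := exists_parameters n s hc hc1
  have hNr : (0 : ℝ) < N := by exact_mod_cast hN
  have hdr : (0 : ℝ) < d := by exact_mod_cast hd
  have : Nonempty (Fin N) := ⟨⟨0, hN⟩⟩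
  have hcardE : (Fintype.card (Option (Fin n) × (Fin n → Fin N)) : ℝ) = (n + 1) * N ^ n := by
    simp
  suffices key : ∃ F : Finset (Option (Fin n) × (Fin n → Fin N)),
      (IsSparse (edgePoint n N) (F : Set _) ∧ ∀ a, edgeDegree (edgePoint n N) F a ≤ d) ∧
      ∀ χ : Fin s × (Fin n × Fin N) → Fin s × (Fin n × Fin N),
        ∃ e ∈ F, e ∈ ({e | MonoEdge χ e ∨ HeteroEdge χ e} : Finset _) by
    obtain ⟨F, hF, hhit⟩ := key
    refine ⟨N, F, hF.1, fun χ => ?_⟩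
    obtain ⟨e, he, h⟩ := hhit χ
    exact ⟨e, he, (mem_filter.1 h).2⟩
  refine exists_greedy_transversal
    (fun χ : Fin s × (Fin n × Fin N) → Fin s × (Fin n × Fin N) =>
      ({e | MonoEdge χ e ∨ HeteroEdge χ e} : Finset (Option (Fin n) × (Fin n → Fin N))))
    (fun F => IsSparse (edgePoint n N) (F : Set _) ∧ ∀ a, edgeDegree (edgePoint n N) F a ≤ d)
    c m ⟨by simpa using isSparse_empty _, fun a => by simp [edgeDegree]⟩ hc1 ?_ ?_ ?_
  · rintro F ⟨hsp, hdeg⟩ hFm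
    -- An edge may be added if its points are pairwise not near, which preserves sparseness, and
    -- none is saturated, which preserves the degree bound.
    refine ⟨({e | (∀ j k, j ≠ k → ¬ Near (edgePoint n N) (F : Set _) (edgePoint n N e j)
      (edgePoint n N e k)) ∧ ∀ j, edgeDegree (edgePoint n N) F (edgePoint n N e j) < d} :
      Finset (Option (Fin n) × (Fin n → Fin N))), ?_, ?_⟩
    · intro e he
      obtain ⟨-, h1, h2⟩ := mem_filter.1 he
      refine ⟨by simpa using hsp.insert h1, fun a => ?_⟩
      refine (edgeDegree_insert_le _ _ _ _).trans ?_
      split_ifs with ha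
      · obtain ⟨j, rfl⟩ := ha
        exact h2 j
      · simpa using hdeg a
    · rw [hcardE]
      set near : Finset ((Fin n × Fin N) × (Fin n × Fin N)) :=
        {p | Near (edgePoint n N) (F : Set _) p.1 p.2} with hnear
      set high : Finset (Fin n × Fin N) := {a | d ≤ edgeDegree (edgePoint n N) F a} with hhigh
      have hnearcard : (#near : ℝ) ≤ n * N * (1 + d * n) ^ 2 := by
        have := card_near_le (edgePoint n N) F d hdeg
        simp only [Fintype.card_prod, Fintype.card_fin] at this
        exact_mod_cast this
      have hhighcard : (#high : ℝ) ≤ m * n / d := by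
        rw [le_div_iff₀ hdr]
        have h1 := card_high_degree_mul_le (edgePoint n N) F d
        rw [Fintype.card_fin] at h1
        have h2 : #high * d ≤ m * n := h1.trans (Nat.mul_le_mul_right _ hFm.le)
        exact_mod_cast h2
      have hsub : ({e | (∀ j k, j ≠ k → ¬ Near (edgePoint n N) (F : Set _) (edgePoint n N e j)
          (edgePoint n N e k)) ∧ ∀ j, edgeDegree (edgePoint n N) F (edgePoint n N e j) < d} :
          Finset (Option (Fin n) × (Fin n → Fin N)))ᶜ ⊆
          ((univ : Finset (Fin n × Fin n)).biUnion fun x => if x.1 ≠ x.2 then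
            ({e | (edgePoint n N e x.1, edgePoint n N e x.2) ∈ near} :
              Finset (Option (Fin n) × (Fin n → Fin N))) else ∅) ∪
          (univ : Finset (Fin n)).biUnion fun j => {e | edgePoint n N e j ∈ high} := by
        intro e he
        rw [mem_compl, mem_filter, not_and] at he
        have he := he (mem_univ _)
        rw [not_and_or] at he
        rcases he with he | he
        · push Not at he
          obtain ⟨j, k, hjk, he⟩ := he
          refine mem_union_left _ (mem_biUnion.2 ⟨(j, k), mem_univ _, ?_⟩)
          rw [if_pos hjk]
          simpa [hnear] using he
        · push Not at he
          obtain ⟨j, he⟩ := he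
          refine mem_union_right _ (mem_biUnion.2 ⟨j, mem_univ _, ?_⟩)
          simpa [hhigh] using he
      have hcard := (card_le_card hsub).trans ((card_union_le _ _).trans
        (add_le_add card_biUnion_le card_biUnion_le))
      have hcard' := (Nat.cast_le (α := ℝ)).2 hcard
      push_cast at hcard'
      refine hcard'.trans ?_
      have hb1 : ∀ x ∈ (univ : Finset (Fin n × Fin n)), (#(if x.1 ≠ x.2 then
            ({e | (edgePoint n N e x.1, edgePoint n N e x.2) ∈ near} :
              Finset (Option (Fin n) × (Fin n → Fin N))) else ∅) : ℝ) ≤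
          (n * N * (1 + d * n) ^ 2 / N ^ 2) * ((n + 1) * N ^ n) := by
        intro x _
        split_ifs with hx
        · have h1 := card_filter_edgePoint_edgePoint_mul_le hx near
          have h1' : (#{e | (edgePoint n N e x.1, edgePoint n N e x.2) ∈ near} : ℝ) * N ^ 2 ≤
              (n + 1) * (#near * N ^ n) := by exact_mod_cast h1
          rw [div_mul_eq_mul_div, le_div_iff₀ (by positivity)]
          refine h1'.trans ?_
          calc ((n : ℝ) + 1) * (#near * N ^ n)
              ≤ (n + 1) * (n * N * (1 + d * n) ^ 2 * N ^ n) := by gcongr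
            _ = _ := by ring
        · simp only [Finset.card_empty, Nat.cast_zero]
          positivity
      have hb2 : ∀ j ∈ (univ : Finset (Fin n)), (#{e | edgePoint n N e j ∈ high} : ℝ) ≤
          (m * n / d / N) * ((n + 1) * N ^ n) := by
        intro j _
        have h1 := card_filter_edgePoint_mul_le j high
        have h1' : (#{e | edgePoint n N e j ∈ high} : ℝ) * N ≤ (n + 1) * (#high * N ^ n) := by
          exact_mod_cast h1
        rw [div_mul_eq_mul_div, le_div_iff₀ (by positivity)]
        refine h1'.trans ?_
        calc ((n : ℝ) + 1) * (#high * N ^ n) ≤ (n + 1) * (m * n / d * N ^ n) := by gcongr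
          _ = _ := by ring
      refine (add_le_add (sum_le_card_nsmul _ _ _ hb1) (sum_le_card_nsmul _ _ _ hb2)).trans ?_
      simp only [card_univ, Fintype.card_prod, Fintype.card_fin, nsmul_eq_mul, Nat.cast_mul]
      calc _ = ((n : ℝ) ^ 2 * (n * N * (1 + d * n) ^ 2 / N ^ 2) + n * (m * n / d / N)) *
            ((n + 1) * N ^ n) := by ring
        _ ≤ _ := by gcongr
  · intro χ
    rw [hcardE]
    refine le_trans (le_of_eq ?_) (le_card_mono_or_hetero χ hδ hn hδ2 hδs)
    rw [hcdef]
    field_simp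
  · simpa using hm

/-- Only the equalities between colours matter, so that the set of colours is arbitrary. -/
theorem exists_code {X β : Type*} (χ : X → β) :
    ∃ χ' : X → X, ∀ x y, χ' x = χ' y ↔ χ x = χ y := by
  classical
  have h : ∀ x, ∃ y, χ y = χ x := fun x => ⟨x, rfl⟩
  have hex : ∀ b : Set.range χ, ∃ y, χ y = b := fun b => b.2
  choose g hg using hex
  refine ⟨fun x => g ⟨χ x, x, rfl⟩, fun x y => ⟨fun h => ?_, fun h => ?_⟩⟩
  · exact (hg ⟨χ x, x, rfl⟩).symm.trans ((congrArg χ h).trans (hg ⟨χ y, y, rfl⟩))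
  · simp only [h]

theorem exists_sparse_partite_hypergraph_of_colouring {n : ℕ} (hn : 0 < n) (s : ℕ) :
    ∃ (N : ℕ) (F : Set (Option (Fin n) × (Fin n → Fin N))), IsSparse (edgePoint n N) F ∧
      ∀ (β : Type z) (χ : Fin s × (Fin n × Fin N) → β),
        ∃ e ∈ F, MonoEdge χ e ∨ HeteroEdge χ e := by
  obtain ⟨N, F, hF, h⟩ := exists_sparse_partite_hypergraph hn s
  refine ⟨N, F, hF, fun β χ => ?_⟩
  obtain ⟨χ', hχ⟩ := exists_code χ
  obtain ⟨e, he, hm⟩ := h χ'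
  refine ⟨e, he, hm.imp ?_ ?_⟩
  · rintro ⟨i, hi, r, q, hq⟩
    refine ⟨i, hi, r, χ (r, edgePoint n N e ⟨0, hn⟩), fun j => ?_⟩
    rw [← hχ, hq, hq]
  · rintro ⟨h0, h1⟩
    exact ⟨h0, fun r t j k hjk heq => h1 r t j k hjk ((hχ _ _).2 heq)⟩

end Partite

/-! ### Free amalgamation classes and irreducible substructures -/

section FreeClass

/-- Of the quantifier-free type, only the atomic formulas `R(x, …, x)` are needed. -/
theorem relMap_iff_of_qfType_eq {L : FirstOrder.Language.{u, v}} {M N : Type w} [L.Structure M]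
    [L.Structure N] {x : M} {y : N} (h : qfType L x = qfType L y) {n : ℕ} (R : L.Relations n) :
    RelMap R (fun _ => x) ↔ RelMap R (fun _ => y) := by
  have hqf : (R.formula fun _ => FirstOrder.Language.Term.var (0 : Fin 1)).IsQF :=
    (FirstOrder.Language.BoundedFormula.IsAtomic.rel _ _).isQF
  have := Set.ext_iff.1 h (R.formula fun _ => FirstOrder.Language.Term.var 0)
  simpa [qfType, hqf, FirstOrder.Language.Formula.realize_rel] using this

/-- A type with a structure on it, as a bundled structure. -/
abbrev bundled (L : FirstOrder.Language.{u, v}) (M : Type w) [S : L.Structure M] :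
    Bundled.{w} L.Structure :=
  ⟨M, S⟩

variable {L : FirstOrder.Language.{u, v}} [L.IsRelational]

/-- A hereditary class of finite structures, closed under free amalgams, all of whose vertices
satisfy the same relations. -/
structure IsTransitiveFreeClass (K : Set (Bundled.{w} L.Structure)) : Prop where
  finite : ∀ M ∈ K, Finite M
  hereditary : Hereditary K
  free_mem : ∀ (A B₀ B₁ C : Bundled.{w} L.Structure)
    (f₀ : A ↪[L] B₀) (f₁ : A ↪[L] B₁) (g₀ : B₀ ↪[L] C) (g₁ : B₁ ↪[L] C),
    A ∈ K → B₀ ∈ K → B₁ ∈ K → IsFreeAmalgam f₀ f₁ g₀ g₁ → C ∈ K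
  transitive : ∀ M ∈ K, ∀ (x y : M) (n : ℕ) (R : L.Relations n),
    RelMap R (fun _ => x) → RelMap R (fun _ => y)

theorem IsFreeAmalgamationClass.isTransitiveFreeClass {K : Set (Bundled.{w} L.Structure)}
    (hK : IsFreeAmalgamationClass K) (ht : IsTransitiveClass K) : IsTransitiveFreeClass K where
  finite M hM := fg_iff_finite.1 (hK.isFraisse.FG M hM)
  hereditary := hK.isFraisse.hereditary
  free_mem := hK.free_mem
  transitive M hM x y _ R := (relMap_iff_of_qfType_eq (ht M hM M hM x y) R).1

/-- In a relational language every set is the domain of a substructure. -/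
def substructureOfSet {M : Type w} [L.Structure M] (S : Set M) : L.Substructure M :=
  ⟨S, fun f => isEmptyElim f⟩

theorem IsTransitiveFreeClass.mem_of_embedding {K : Set (Bundled.{w} L.Structure)}
    (hK : IsTransitiveFreeClass K) {M N : Type w} [L.Structure M] [L.Structure N]
    (hN : bundled L N ∈ K) (f : M ↪[L] N) : bundled L M ∈ K := by
  have : Finite N := hK.finite _ hN
  have : Finite M := Finite.of_injective f f.injective
  exact hK.hereditary _ hN ⟨fg_iff_finite.2 this, ⟨f⟩⟩

/-- A finite structure belongs to a free amalgamation class if its irreducible substructures do. -/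
theorem IsTransitiveFreeClass.substructure_mem_of_irreducible {K : Set (Bundled.{w} L.Structure)}
    (hK : IsTransitiveFreeClass K) {M : Type w} [L.Structure M] [Finite M]
    (h : ∀ S : L.Substructure M, (∀ a ∈ S, ∀ b ∈ S, a ≠ b → ∃ (n : ℕ) (R : L.Relations n)
      (x : Fin n → M), RelMap R x ∧ (∀ i, x i ∈ S) ∧ a ∈ Set.range x ∧ b ∈ Set.range x) →
      bundled L S ∈ K) (S : L.Substructure M) : bundled L S ∈ K := by
  induction hm : (S : Set M).ncard using Nat.strong_induction_on generalizing S with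
  | _ m ih =>
    by_cases hirr : ∀ a ∈ S, ∀ b ∈ S, a ≠ b → ∃ (n : ℕ) (R : L.Relations n)
      (x : Fin n → M), RelMap R x ∧ (∀ i, x i ∈ S) ∧ a ∈ Set.range x ∧ b ∈ Set.range x
    · exact h S hirr
    push Not at hirr
    obtain ⟨a, ha, b, hb, hab, hirr⟩ := hirr
    -- No related tuple in `S` contains both `a` and `b`, so `S` is the free amalgam of `S \ {a}`
    -- and `S \ {b}` over `S \ {a, b}`; induct on size.
    let Sa : L.Substructure M := substructureOfSet ((S : Set M) \ {a})
    let Sb : L.Substructure M := substructureOfSet ((S : Set M) \ {b})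
    let Sab : L.Substructure M := substructureOfSet ((S : Set M) \ {a, b})
    have hSa : Sa ≤ S := fun x hx => hx.1
    have hSb : Sb ≤ S := fun x hx => hx.1
    have hSaba : Sab ≤ Sa := fun x hx => ⟨hx.1, fun hxa => hx.2 (Or.inl hxa)⟩
    have hSabb : Sab ≤ Sb := fun x hx => ⟨hx.1, fun hxb => hx.2 (Or.inr hxb)⟩
    have hlt : ∀ c ∈ S, ((S : Set M) \ {c}).ncard < m := fun c hc =>
      hm ▸ Set.ncard_sdiff_singleton_lt_of_mem hc
    have hSaK : bundled L Sa ∈ K := ih _ (hlt a ha) Sa rfl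
    have hSbK : bundled L Sb ∈ K := ih _ (hlt b hb) Sb rfl
    refine hK.free_mem (bundled L Sab) (bundled L Sa) (bundled L Sb) (bundled L S)
      (FirstOrder.Language.Substructure.inclusion hSaba)
      (FirstOrder.Language.Substructure.inclusion hSabb)
      (FirstOrder.Language.Substructure.inclusion hSa)
      (FirstOrder.Language.Substructure.inclusion hSb)
      (hK.mem_of_embedding hSaK (FirstOrder.Language.Substructure.inclusion hSaba)) hSaK hSbK
      ⟨?_, ?_, ?_, ?_⟩
    · rfl
    · refine Set.eq_univ_of_forall fun x => ?_
      by_cases hxa : (x : M) = a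
      · exact Or.inr ⟨⟨x, x.2, fun hxb => hab (hxa.symm.trans hxb)⟩, rfl⟩
      · exact Or.inl ⟨⟨x, x.2, hxa⟩, rfl⟩
    · ext x
      constructor
      · rintro ⟨⟨⟨y, hy⟩, rfl⟩, ⟨⟨y', hy'⟩, h'⟩⟩
        have hyy : y' = y := congrArg Subtype.val h'
        subst hyy
        exact ⟨⟨y', hy.1, by rintro (h1 | h1); exacts [hy.2 h1, hy'.2 h1]⟩, rfl⟩
      · rintro ⟨y, rfl⟩
        exact ⟨⟨FirstOrder.Language.Substructure.inclusion hSaba y, rfl⟩,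
          ⟨FirstOrder.Language.Substructure.inclusion hSabb y, rfl⟩⟩
    · intro n R x
      constructor
      · intro hx
        by_cases hxa : ∃ i, (x i : M) = a
        · right
          have hxb : ∀ i, (x i : M) ≠ b := fun i hi =>
            hirr n R (fun i => (x i : M)) hx (fun i => (x i).2) hxa ⟨i, hi⟩
          exact ⟨fun i => ⟨x i, (x i).2, hxb i⟩, hx, rfl⟩
        · left
          push Not at hxa
          exact ⟨fun i => ⟨x i, (x i).2, hxa i⟩, hx, rfl⟩
      · rintro (⟨y, hy, rfl⟩ | ⟨y, hy, rfl⟩)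
        · exact hy
        · exact hy

end FreeClass

/-! ### Gluing copies of `B` along a sparse hypergraph -/

section Gluing

theorem relMap_of_constant {L : FirstOrder.Language.{u, v}} {B : Type*} [L.Structure B]
    (htr : ∀ (x y : B) (n : ℕ) (R : L.Relations n), RelMap R (fun _ => x) → RelMap R (fun _ => y))
    {n : ℕ} {R : L.Relations n} {x y : Fin n → B} (hx : ∀ i j, x i = x j)
    (hy : ∀ i j, y i = y j) (h : RelMap R x) : RelMap R y := by
  rcases n with _ | n
  · rwa [Subsingleton.elim y x]
  · rw [show x = fun _ => x 0 from funext fun i => hx i 0] at h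
    rw [show y = fun _ => y 0 from funext fun i => hy i 0]
    exact htr _ _ _ _ h

variable {L : FirstOrder.Language.{u, v}} [L.IsRelational] {B V E : Type*} [L.Structure B]

/-- The structure obtained by placing a copy of `B` on each edge of a hypergraph; the vertices
outside all edges satisfy the same relations as the vertices of `B`. -/
@[reducible]
def gluedStructure (L : FirstOrder.Language.{u, v}) [L.IsRelational] {B V E : Type*}
    [L.Structure B] (pt : E → B → V) (F : Set E) : L.Structure V where
  funMap f := isEmptyElim f
  RelMap R x := (∃ e ∈ F, ∃ y, RelMap R y ∧ pt e ∘ y = x) ∨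
    (∃ b : B, RelMap R (fun _ => b)) ∧ ∀ i j, x i = x j

/-- A tuple lying on two distinct edges is constant by linearity, and transitivity gives constant
tuples the same relations at every vertex. Hence gluing adds no relations to a copy of `B`. -/
theorem relMap_edge_iff
    (htr : ∀ (x y : B) (n : ℕ) (R : L.Relations n), RelMap R (fun _ => x) → RelMap R (fun _ => y))
    {pt : E → B → V} {F : Set E} (hF : IsSparse pt F) {e : E} (he : e ∈ F) {n : ℕ}
    (R : L.Relations n) (y : Fin n → B) :
    (gluedStructure L pt F).RelMap R (pt e ∘ y) ↔ RelMap R y := by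
  refine ⟨?_, fun h => Or.inl ⟨e, he, y, h, rfl⟩⟩
  rintro (⟨e', he', y', h, heq⟩ | ⟨⟨b, h⟩, hconst⟩)
  · have hi : ∀ i, pt e' (y' i) = pt e (y i) := congrFun heq
    by_cases hee : e = e'
    · subst hee
      rwa [← show y' = y from funext fun i => hF.inj e he (hi i)]
    have hc : ∀ i j, pt e (y i) = pt e (y j) := fun i j => by
      by_contra hne
      exact hee (hF.linear e he e' he' _ _ hne ⟨_, rfl⟩ ⟨_, rfl⟩ ⟨_, hi i⟩ ⟨_, hi j⟩)
    refine relMap_of_constant htr (fun i j => ?_) (fun i j => hF.inj e he (hc i j)) h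
    exact hF.inj e' he' (by rw [hi, hi, hc i j])
  · exact relMap_of_constant htr (fun _ _ => rfl) (fun i j => hF.inj e he (hconst i j)) h

theorem relMap_constant_iff
    (htr : ∀ (x y : B) (n : ℕ) (R : L.Relations n), RelMap R (fun _ => x) → RelMap R (fun _ => y))
    {pt : E → B → V} {F : Set E} (hF : IsSparse pt F) {n : ℕ}
    (R : L.Relations n) {x : Fin n → V} (hx : ∀ i j, x i = x j) (b : B) :
    (gluedStructure L pt F).RelMap R x ↔ RelMap R (fun _ => b) := by
  refine ⟨?_, fun h => Or.inr ⟨⟨b, h⟩, hx⟩⟩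
  rintro (⟨e, he, y, h, rfl⟩ | ⟨⟨b', h⟩, -⟩)
  · exact relMap_of_constant htr (fun i j => hF.inj e he (hx i j)) (fun _ _ => rfl) h
  · exact htr _ _ _ _ h

/-- The copy of `B` on an edge. -/
def edgeEmbedding
    (htr : ∀ (x y : B) (n : ℕ) (R : L.Relations n), RelMap R (fun _ => x) → RelMap R (fun _ => y))
    {pt : E → B → V} {F : Set E} (hF : IsSparse pt F) {e : E} (he : e ∈ F) :
    letI := gluedStructure L pt F
    B ↪[L] V :=
  letI := gluedStructure L pt F
  { toFun := pt e
    inj' := hF.inj e he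
    map_fun' := fun f => isEmptyElim f
    map_rel' := fun R y => relMap_edge_iff htr hF he R y }

/-- Two distinct vertices in a common related tuple are collinear. So an irreducible substructure is
either at most one point, which embeds in `B` by transitivity, or lies in one edge by sparseness. -/
theorem IsTransitiveFreeClass.glued_mem {K : Set (Bundled.{w} L.Structure)}
    (hK : IsTransitiveFreeClass K) {B V : Type w} {E : Type*} [L.Structure B] [Nonempty B]
    [Finite V] (hB : bundled L B ∈ K) {pt : E → B → V} {F : Set E} (hF : IsSparse pt F) :
    (⟨V, gluedStructure L pt F⟩ : Bundled.{w} L.Structure) ∈ K := by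
  let := gluedStructure L pt F
  have htr := hK.transitive _ hB
  have key : ∀ S : L.Substructure V, bundled L S ∈ K := by
    refine hK.substructure_mem_of_irreducible fun S hS => ?_
    have hcol : ∀ a ∈ (S : Set V), ∀ b ∈ (S : Set V), a ≠ b → Collinear pt F a b := by
      intro a ha b hb hab
      obtain ⟨n, R, x, hx, -, ⟨i, rfl⟩, ⟨j, rfl⟩⟩ := hS a ha b hb hab
      rcases hx with ⟨e, he, y, -, rfl⟩ | ⟨-, hconst⟩
      · exact ⟨e, he, ⟨_, rfl⟩, ⟨_, rfl⟩⟩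
      · exact absurd (hconst i j) hab
    rcases (S : Set V).subsingleton_or_nontrivial with hsub | hnt
    · obtain ⟨b⟩ := ‹Nonempty B›
      have hsub' : ∀ x y : S, x = y := fun x y => Subtype.ext (hsub x.2 y.2)
      refine hK.mem_of_embedding hB
        { toFun := fun _ => b
          inj' := fun x y _ => hsub' x y
          map_fun' := fun f => isEmptyElim f
          map_rel' := fun R x => ?_ }
      exact (relMap_constant_iff htr hF R
        (x := fun i => (x i : V)) (fun i j => congrArg Subtype.val (hsub' _ _)) b).symm
    · obtain ⟨e, he, hSe⟩ := hF.subset_edge hcol hnt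
      choose g hg using fun x : S => hSe x.2
      refine hK.mem_of_embedding hB
        { toFun := g
          inj' := fun x y hxy => Subtype.ext (by rw [← hg, ← hg, hxy])
          map_fun' := fun f => isEmptyElim f
          map_rel' := fun R x => ?_ }
      rw [← relMap_edge_iff htr hF he R]
      have : pt e ∘ g ∘ x = fun i => (x i : V) := funext fun i => hg (x i)
      rw [this]
      rfl
  exact hK.mem_of_embedding (key ⊤)
    (FirstOrder.Language.Substructure.topEquiv (L := L) (M := V)).symm.toEmbedding

theorem IsSparse.map {ι ι' V V' E : Type*} {pt : E → ι → V} {F : Set E} (hF : IsSparse pt F)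
    (φ : ι' ≃ ι) (ψ : V ≃ V') : IsSparse (fun e i => ψ (pt e (φ i))) F := by
  have hr : ∀ e a, a ∈ Set.range (fun i => ψ (pt e (φ i))) ↔ ψ.symm a ∈ Set.range (pt e) := by
    intro e a
    constructor
    · rintro ⟨i, rfl⟩
      exact ⟨φ i, by simp⟩
    · rintro ⟨i, hi⟩
      exact ⟨φ.symm i, by simp [hi]⟩
  have hc : ∀ a b, Collinear (fun e i => ψ (pt e (φ i))) F a b ↔
      Collinear pt F (ψ.symm a) (ψ.symm b) := by
    intro a b
    simp only [Collinear, hr]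
  refine ⟨fun e he => ψ.injective.comp ((hF.inj e he).comp φ.injective), ?_, ?_⟩
  · intro e he e' he' a b hab
    simp only [hr]
    exact hF.linear e he e' he' _ _ (ψ.symm.injective.ne hab)
  · intro a b c hab hbc hac
    simp only [hr, hc]
    exact hF.triangle _ _ _ (ψ.symm.injective.ne hab) (ψ.symm.injective.ne hbc)
      (ψ.symm.injective.ne hac)

end Gluing

/-! ### The very canonical vertex-Ramsey and sunflower properties -/

section Ramsey

variable {L : FirstOrder.Language.{u, v}} [L.IsRelational]

/-- A form of the very canonical vertex-Ramsey property for colours in any type, where moreover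
distinct vertices of the transversal copy do not share a colour in two different colourings. -/
theorem IsTransitiveFreeClass.exists_partition {K : Set (Bundled.{w} L.Structure)}
    (hK : IsTransitiveFreeClass K) (s : ℕ) (B : Bundled.{w} L.Structure) (hB : B ∈ K) :
    ∃ C ∈ K, ∃ V : Fin (Nat.card B) → Set C, IsPartition V ∧
      ∀ (β : Type z) (χ : Fin s → C → β),
        (∃ (r : Fin s) (i : Fin (Nat.card B)) (B' : L.Substructure C),
          (B' : Set C) ⊆ V i ∧ Nonempty (B' ≃[L] B) ∧ ∃ q, ∀ x ∈ B', χ r x = q) ∨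
        (∃ B' : L.Substructure C, IsTransversal V (B' : Set C) ∧ Nonempty (B' ≃[L] B) ∧
          ∀ r t, ∀ x ∈ B', ∀ y ∈ B', x ≠ y → χ r x ≠ χ t y) := by
  classical
  have hfin : Finite B := hK.finite _ hB
  -- The hypergraph needs `n > 0`. For empty `B` there are no parts, and `B` itself is a transversal
  -- copy.
  rcases isEmpty_or_nonempty B with hempty | hne
  · have hcard : Nat.card B = 0 := Nat.card_of_isEmpty
    have : IsEmpty (Fin (Nat.card B)) := by rw [hcard]; infer_instance
    refine ⟨B, hB, isEmptyElim, ⟨isEmptyElim, Subsingleton.elim _ _⟩, fun β χ => Or.inr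
      ⟨⊤, ⟨?_, isEmptyElim⟩, ⟨FirstOrder.Language.Substructure.topEquiv⟩,
        fun r t x => isEmptyElim x⟩⟩
    rw [hcard, Nat.cast_zero, Set.encard_eq_zero]
    exact Set.eq_empty_of_isEmpty _
  have hn : 0 < Nat.card B := Nat.card_pos
  obtain ⟨N, F, hF, hcol⟩ := exists_sparse_partite_hypergraph_of_colouring.{z} hn s
  let φ : B ≃ Fin (Nat.card B) := Finite.equivFin B
  let ψ : Fin (Nat.card B) × Fin N ≃ ULift.{w} (Fin (Nat.card B) × Fin N) := Equiv.ulift.symm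
  let pt : Option (Fin (Nat.card B)) × (Fin (Nat.card B) → Fin N) → B →
      ULift.{w} (Fin (Nat.card B) × Fin N) := fun e b => ψ (edgePoint _ N e (φ b))
  have hpt : IsSparse pt F := hF.map φ ψ
  let := gluedStructure L pt F
  have htr := hK.transitive _ hB
  refine ⟨⟨_, gluedStructure L pt F⟩, hK.glued_mem hB hpt, fun i => {x | x.down.1 = i}, ⟨?_, ?_⟩,
    fun β χ => ?_⟩
  · intro i j hij
    exact Set.disjoint_left.2 fun x hi hj => hij (Eq.trans (Eq.symm hi) hj)
  · exact Set.eq_univ_of_forall fun x => Set.mem_iUnion.2 ⟨x.down.1, rfl⟩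
  obtain ⟨e, he, h⟩ := hcol β fun p => χ p.1 (ψ p.2)
  let f : B ↪[L] ULift.{w} (Fin (Nat.card B) × Fin N) := edgeEmbedding htr hpt he
  have hf : ∀ b, f b = pt e b := fun _ => rfl
  refine h.imp ?_ ?_
  · rintro ⟨i, hi, r, q, hq⟩
    refine ⟨r, i, f.toHom.range, ?_, ⟨f.equivRange.symm⟩, q, ?_⟩
    · rintro _ ⟨b, rfl⟩
      change (edgePoint _ N e (φ b)).1 = i
      simp [edgePoint, hi]
    · rintro _ ⟨b, rfl⟩
      exact hq (φ b)
  · rintro ⟨h0, h1⟩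
    have hpart : ∀ b, (f b).down.1 = φ b := fun b => by
      change (edgePoint _ N e (φ b)).1 = φ b
      simp [edgePoint, h0]
    have hrange : (f.toHom.range : Set (ULift.{w} (Fin (Nat.card B) × Fin N))) = Set.range f := rfl
    refine ⟨f.toHom.range, ⟨?_, fun i => ?_⟩, ⟨f.equivRange.symm⟩, ?_⟩
    · refine (congrArg Set.encard hrange).trans ?_
      rw [← Set.image_univ, f.injective.encard_image, Set.encard_univ, ENat.card_eq_coe_natCard]
    · refine Set.encard_eq_one.2 ⟨f (φ.symm i), ?_⟩
      ext x
      constructor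
      · rintro ⟨⟨b, rfl⟩, hb⟩
        have hb' : φ b = i := (hpart b).symm.trans hb
        rw [← hb', Equiv.symm_apply_apply]
        rfl
      · rintro rfl
        exact ⟨⟨φ.symm i, rfl⟩, (hpart _).trans (φ.apply_symm_apply i)⟩
    · rintro r t _ ⟨b, rfl⟩ _ ⟨b', rfl⟩ hbb
      exact h1 r t (φ b) (φ b') (φ.injective.ne fun h => hbb (h ▸ rfl))

theorem IsTransitiveFreeClass.veryCanonicalVertexRamsey {K : Set (Bundled.{w} L.Structure)}
    (hK : IsTransitiveFreeClass K) : VeryCanonicalVertexRamsey K := by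
  intro s _ B hB
  obtain ⟨C, hC, V, hV, h⟩ := hK.exists_partition.{u, v, w, 0} s B hB
  refine ⟨C, hC, V, hV, fun χ => (h ℕ χ).imp_right ?_⟩
  rintro ⟨B', hB', hiso, hχ⟩
  refine ⟨B', hB', hiso, fun r x hx y hy hxy => ?_⟩
  by_contra hne
  exact hχ r r x hx y hy hne hxy

/-- The sunflower property for families of sets indexed by a structure. -/
theorem IsTransitiveFreeClass.exists_sunflower {K : Set (Bundled.{w} L.Structure)}
    (hK : IsTransitiveFreeClass K) (k : ℕ) (B : Bundled.{w} L.Structure) (hB : B ∈ K) :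
    ∃ C ∈ K, ∀ (α : Type z) (g : C → Set α), (∀ x, (g x).encard = k) →
      ∃ S : L.Substructure C, Nonempty (S ≃[L] B) ∧
        ∃ c, ∀ x ∈ S, ∀ y ∈ S, x ≠ y → g x ∩ g y = c := by
  induction k with
  | zero =>
    refine ⟨B, hB, fun α g hg => ⟨⊤, ⟨FirstOrder.Language.Substructure.topEquiv⟩, ∅, ?_⟩⟩
    intro x _ y _ _
    have hx : g x = ∅ := Set.encard_eq_zero.1 (by simpa using hg x)
    rw [hx, Set.empty_inter]
  | succ k ih =>
    obtain ⟨C, hC, hsun⟩ := ih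
    obtain ⟨D, hD, V, -, h⟩ := hK.exists_partition.{u, v, w, z} (k + 1) C hC
    refine ⟨D, hD, fun α g hg => ?_⟩
    have hen : ∀ x, ∃ en : Fin (k + 1) → α, Set.range en = g x := fun x => by
      have hfin : (g x).Finite := Set.finite_of_encard_eq_coe (hg x)
      have := hfin.to_subtype
      have hcard : Nat.card (g x) = k + 1 := by
        have h1 : (g x).ncard = k + 1 := by
          rw [Set.ncard_def, hg x, ENat.toNat_natCast]
        exact h1
      let φ := Finite.equivFinOfCardEq hcard
      refine ⟨fun i => (φ.symm i : α), ?_⟩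
      ext a
      constructor
      · rintro ⟨i, rfl⟩
        exact (φ.symm i).2
      · exact fun ha => ⟨φ ⟨a, ha⟩, by simp⟩
    choose en hen using hen
    -- The `r`-th colour of a vertex is the `r`-th element of its set, so the colours are points of
    -- `α`. In the first case `q` lies in every set of the copy, and removing it reduces `k + 1` to
    -- `k`.
    rcases h α fun r x => en x r with ⟨r, i, B', -, ⟨ψ⟩, q, hq⟩ | ⟨B', -, ⟨ψ⟩, hdisj⟩
    · let f : C ↪[L] D := B'.subtype.comp ψ.symm.toEmbedding
      have hfB : ∀ x, f x ∈ B' := fun x => (ψ.symm x).2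
      have hqg : ∀ x, q ∈ g (f x) := fun x => by
        rw [← hen, ← hq _ (hfB x)]
        exact ⟨r, rfl⟩
      obtain ⟨S, ⟨χ⟩, c, hc⟩ := hsun α (fun x => g (f x) \ {q}) fun x => by
        have h1 := Set.encard_sdiff_singleton_add_one (hqg x)
        rw [hg] at h1
        push_cast at h1
        exact ENat.add_left_injective_of_ne_top ENat.one_ne_top h1
      refine ⟨S.map f.toHom, ⟨χ.comp (f.substructureEquivMap S).symm⟩, insert q c, ?_⟩
      rintro _ ⟨x, hx, rfl⟩ _ ⟨y, hy, rfl⟩ hxy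
      have h1 := hc x hx y hy fun h => hxy (h ▸ rfl)
      change g (f x) ∩ g (f y) = _
      rw [← h1]
      ext a
      by_cases ha : a = q
      · simp [ha, hqg]
      · simp [ha]
    · let f : C ↪[L] D := B'.subtype.comp ψ.symm.toEmbedding
      have hfB : ∀ x, f x ∈ B' := fun x => (ψ.symm x).2
      -- The sets on this copy of `C` are already disjoint, so only a copy of `B` inside `C` is
      -- needed. The induction hypothesis gives one from a constant family, since families need not
      -- be injective.
      obtain ⟨S, ⟨χ⟩, -⟩ := hsun (ULift.{z} (Fin k)) (fun _ => Set.univ) fun _ => by simp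
      refine ⟨S.map f.toHom, ⟨χ.comp (f.substructureEquivMap S).symm⟩, ∅, ?_⟩
      rintro _ ⟨x, hx, rfl⟩ _ ⟨y, hy, rfl⟩ hxy
      change g (f x) ∩ g (f y) = _
      rw [← Set.disjoint_iff_inter_eq_empty, Set.disjoint_left, ← hen, ← hen]
      rintro _ ⟨i, rfl⟩ ⟨j, hj⟩
      exact hdisj i j _ (hfB x) _ (hfB y) hxy hj.symm

theorem IsTransitiveFreeClass.finiteSunflowerProperty {K : Set (Bundled.{w} L.Structure)}
    (hK : IsTransitiveFreeClass K) : FiniteSunflowerProperty.{u, v, w, z} K := by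
  intro k _ B hB
  obtain ⟨C, hC, h⟩ := hK.exists_sunflower.{u, v, w, z} k B hB
  refine ⟨C, hC, fun α D _ hD ⟨ψ⟩ => ?_⟩
  obtain ⟨S, ⟨χ⟩, c, hc⟩ := h α (fun x => (ψ.symm x : Set α)) fun x => hD _ (ψ.symm x).2
  let f : C ↪[L] D := ψ.symm.toEmbedding
  refine ⟨S.map f.toHom, ⟨χ.comp (f.substructureEquivMap S).symm⟩, c, ?_⟩
  rintro _ ⟨_, ⟨x, hx, rfl⟩, rfl⟩ _ ⟨_, ⟨y, hy, rfl⟩, rfl⟩ hxy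
  exact hc x hx y hy fun h => hxy (h ▸ rfl)

end Ramsey

/-! ### Clique-free graphs -/

section Graphs

theorem str_eq_structure {V : Type*} (S : FirstOrder.Language.graph.Structure V)
    (G : SimpleGraph V) (h : ∀ a b, S.RelMap FirstOrder.Language.adj ![a, b] ↔ G.Adj a b) :
    S = G.structure := by
  ext
  case funMap n f xs => exact isEmptyElim f
  case RelMap n r xs =>
    cases r
    change _ ↔ G.Adj (xs 0) (xs 1)
    rw [← h]
    have : xs = ![xs 0, xs 1] := funext fun i => by fin_cases i <;> rfl
    rw [← this]

theorem mem_cliqueFreeGraphs_iff {n : ℕ} {M : Bundled.{w} FirstOrder.Language.graph.Structure} :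
    M ∈ cliqueFreeGraphs n ↔ Finite M ∧ ∃ G : SimpleGraph M,
      (∀ a b, M.str.RelMap FirstOrder.Language.adj ![a, b] ↔ G.Adj a b) ∧ G.CliqueFree n := by
  refine and_congr_right fun _ => exists_congr fun G => and_congr_left fun _ => ?_
  refine ⟨fun h a b => ?_, fun h => str_eq_structure _ _ h⟩
  rw [h]
  rfl

theorem adj_embedding_iff {M N : Type*} [FirstOrder.Language.graph.Structure M]
    [FirstOrder.Language.graph.Structure N] (f : M ↪[FirstOrder.Language.graph] N) (a b : M) :
    RelMap FirstOrder.Language.adj ![f a, f b] ↔ RelMap FirstOrder.Language.adj ![a, b] := by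
  rw [← f.map_rel]
  have : ![f a, f b] = f ∘ ![a, b] := funext fun i => by fin_cases i <;> rfl
  rw [this]

/-- A free amalgam has no edges between the two sides outside the common part, so each clique lies
in one side. Transitivity holds because graphs have no loops. The full Fraïssé axioms are not
required, so `n = 0`, where the class is empty, needs no exception. -/
theorem isTransitiveFreeClass_cliqueFreeGraphs (n : ℕ) :
    IsTransitiveFreeClass (cliqueFreeGraphs.{w} n) where
  finite M hM := hM.1
  hereditary := by
    rintro M hM N ⟨hN, ⟨f⟩⟩
    obtain ⟨hfin, G, hG, hcf⟩ := mem_cliqueFreeGraphs_iff.1 hM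
    refine mem_cliqueFreeGraphs_iff.2 ⟨Finite.of_injective f f.injective, G.comap f, ?_, ?_⟩
    · intro a b
      rw [SimpleGraph.comap_adj, ← hG]
      exact (adj_embedding_iff f a b).symm
    · exact hcf.comap ⟨(SimpleGraph.Embedding.comap f.toEmbedding G).toCopy⟩
  free_mem := by
    intro A B₀ B₁ C f₀ f₁ g₀ g₁ _ hB₀ hB₁ h
    obtain ⟨hfin₀, G₀, hG₀, hcf₀⟩ := mem_cliqueFreeGraphs_iff.1 hB₀
    obtain ⟨hfin₁, G₁, hG₁, hcf₁⟩ := mem_cliqueFreeGraphs_iff.1 hB₁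
    have hadj : ∀ a b : C, RelMap FirstOrder.Language.adj ![a, b] ↔
        (∃ a' b', G₀.Adj a' b' ∧ g₀ a' = a ∧ g₀ b' = b) ∨
        (∃ a' b', G₁.Adj a' b' ∧ g₁ a' = a ∧ g₁ b' = b) := by
      intro a b
      constructor
      · intro hab
        refine ((h.relMap_iff _ _ _).1 hab).imp ?_ ?_
        · rintro ⟨y, hy, hyx⟩
          have : y = ![y 0, y 1] := funext fun i => by fin_cases i <;> rfl
          rw [this] at hy
          exact ⟨y 0, y 1, (hG₀ _ _).1 hy, congrFun hyx 0, congrFun hyx 1⟩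
        · rintro ⟨y, hy, hyx⟩
          have : y = ![y 0, y 1] := funext fun i => by fin_cases i <;> rfl
          rw [this] at hy
          exact ⟨y 0, y 1, (hG₁ _ _).1 hy, congrFun hyx 0, congrFun hyx 1⟩
      · rintro (⟨a', b', hab, rfl, rfl⟩ | ⟨a', b', hab, rfl, rfl⟩)
        · exact (adj_embedding_iff g₀ _ _).2 ((hG₀ _ _).2 hab)
        · exact (adj_embedding_iff g₁ _ _).2 ((hG₁ _ _).2 hab)
    have hfinC : Finite C := by
      have := (Set.finite_range g₀).union (Set.finite_range g₁)
      rw [h.union_eq] at this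
      exact Set.finite_univ_iff.1 this
    let G : SimpleGraph C :=
      { Adj := fun a b => RelMap FirstOrder.Language.adj ![a, b]
        symm := ⟨fun a b hab => by
          rw [hadj] at hab ⊢
          exact hab.imp (fun ⟨a', b', h1, h2, h3⟩ => ⟨b', a', h1.symm, h3, h2⟩)
            (fun ⟨a', b', h1, h2, h3⟩ => ⟨b', a', h1.symm, h3, h2⟩)⟩
        loopless := ⟨fun a haa => by
          rcases (hadj _ _).1 haa with ⟨a', b', h1, h2, h3⟩ | ⟨a', b', h1, h2, h3⟩
          · exact h1.ne (g₀.injective (h2.trans h3.symm))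
          · exact h1.ne (g₁.injective (h2.trans h3.symm))⟩ }
    have hGadj : ∀ a b, G.Adj a b ↔ RelMap FirstOrder.Language.adj ![a, b] := fun _ _ => Iff.rfl
    refine mem_cliqueFreeGraphs_iff.2 ⟨hfinC, G, fun a b => (hGadj a b).symm, ?_⟩
    intro t ht
    have hcase : (t : Set C) ⊆ Set.range g₀ ∨ (t : Set C) ⊆ Set.range g₁ := by
      by_contra! hcon
      obtain ⟨⟨a, hat, ha⟩, ⟨b, hbt, hb⟩⟩ := And.imp Set.not_subset.1 Set.not_subset.1 hcon
      have ha₁ : a ∈ Set.range g₁ := by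
        have : a ∈ Set.range g₀ ∪ Set.range g₁ := h.union_eq ▸ Set.mem_univ a
        exact this.resolve_left ha
      have hab : a ≠ b := fun heq => hb (heq ▸ ha₁)
      rcases (hadj _ _).1 ((hGadj _ _).1 (ht.isClique hat hbt hab)) with
        ⟨a', b', -, h2, -⟩ | ⟨a', b', -, -, h3⟩
      · exact ha ⟨a', h2⟩
      · exact hb ⟨b', h3⟩
    -- A clique inside the image of one side pulls back to a clique of the same size there.
    have hpull : ∀ {B : Type w} (H : SimpleGraph B) (g : B → C), Function.Injective g →
        (∀ a b, G.Adj (g a) (g b) ↔ H.Adj a b) → (t : Set C) ⊆ Set.range g →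
        ¬ H.CliqueFree n := by
      classical
      intro B H g hg hH hsub hcf
      have hinj : Set.InjOn g (g ⁻¹' (t : Set C)) := hg.injOn
      refine hcf (t.preimage g hinj) ⟨?_, ?_⟩
      · intro a ha b hb hab
        rw [← hH]
        exact ht.isClique (Finset.mem_preimage.1 ha) (Finset.mem_preimage.1 hb) (hg.ne hab)
      · rw [← ht.card_eq, ← Finset.card_image_of_injective _ hg]
        congr 1
        ext x
        simp only [Finset.mem_image, Finset.mem_preimage]
        constructor
        · rintro ⟨a, ha, rfl⟩
          exact ha
        · intro hx
          obtain ⟨a, rfl⟩ := hsub hx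
          exact ⟨a, hx, rfl⟩
    rcases hcase with hsub | hsub
    · exact hpull G₀ g₀ g₀.injective
        (fun a b => (adj_embedding_iff g₀ a b).trans (hG₀ a b)) hsub hcf₀
    · exact hpull G₁ g₁ g₁.injective
        (fun a b => (adj_embedding_iff g₁ a b).trans (hG₁ a b)) hsub hcf₁
  transitive := by
    rintro M ⟨-, G, hG, -⟩ x y m R hx
    replace hx : M.str.RelMap R (fun _ => x) := hx
    rw [hG] at hx
    cases R
    exact absurd hx (G.loopless.irrefl x)

end Graphs

end VertexRamsey

theorem theoremt :
    (∀ (L : FirstOrder.Language.{u, v}) [L.IsRelational]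
        (K : Set (CategoryTheory.Bundled.{w} L.Structure)),
      VertexRamsey.IsFreeAmalgamationClass K → VertexRamsey.IsTransitiveClass K →
        VertexRamsey.VeryCanonicalVertexRamsey K ∧
          VertexRamsey.FiniteSunflowerProperty.{u, v, w, z} K) ∧
    (∀ n : ℕ, VertexRamsey.FiniteSunflowerProperty.{0, 0, w, z}
      (VertexRamsey.cliqueFreeGraphs.{w} n)) := by
  refine ⟨fun L _ K hK ht => ?_, fun n => ?_⟩
  · have h := hK.isTransitiveFreeClass ht
    exact ⟨h.veryCanonicalVertexRamsey, h.finiteSunflowerProperty⟩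
  · exact (VertexRamsey.isTransitiveFreeClass_cliqueFreeGraphs n).finiteSunflowerProperty
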